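/- A polynomial map is a map $f:\mathbb{Z}^{\mathbb{N}}\to\mathbb{Z}^{\mathbb{N}}$ each of whose components is an integer polynomial in finitely many of the coordinates. For a set $S$ of polynomial maps, let $\langle S\rangle$ be the monoid generated by $S$ under composition (with the identity). A point $x\in\mathbb{Z}^{\mathbb{N}}$ is called $S$-stable if its $S$-orbit $\{g(x): g\in\langle S\rangle\}$ is finite. A polynomial map $f$ is presented by a program that halts on every $i\in\mathbb{N}$ and outputs a written form (a finite list of terms) of a polynomial giving the $i$-th component of $f$; a point $x$ is presented by a program that halts on every $i$ and outputs $x_i$; a finite set of maps is presented by a finite list of programs presenting its elements. **Theorem 1.3.** It is undecidable, given a finite set $S$ of polynomial maps on $\mathbb{Z}^{\mathbb{N}}$ and a point $x\in\mathbb{Z}^{\mathbb{N}}$, whether or not $x$ is $S$-stable. That is, there is no algorithm which, given any programs presenting a finite set $S$ of polynomial maps and a point $x$, halts and answers correctly whether $x$ is $S$-stable (nothing being required of it on other inputs). Moreover, this holds already for a single fixed map: there is a polynomial map $f$, presented by some program, such that it is undecidable, given a finite list of integers $(l_0,\dots,l_{n-1})$, whether the point $x=(l_0,\dots,l_{n-1},0,0,\dots)$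 is $\{f\}$-stable, and likewise undecidable whether $f^k(x)=f^m(x)$ for some integers $k>m\ge 0$. For every polynomial map $f$ and every $x\in\mathbb{Z}^{\mathbb{N}}$, the point $x$ is $\{f\}$-stable if and only if $f^k(x)=f^m(x)$ for some integers $k>m\ge 0$. -/

import Mathlib

open Nat.Partrec (Code)

namespace PolyOrbit

/-- The set `ℤ^ℕ` of integer sequences. -/
abbrev Pt : Type := ℕ → ℤ

/-- `f : ℤ^ℕ → ℤ^ℕ` is a polynomial map: every component is (the evaluation of) an integer
polynomial in finitely many of the variables `X 0, X 1, …`. -/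
def IsPolynomialMap (f : Pt → Pt) : Prop :=
  ∀ i : ℕ, ∃ p : MvPolynomial ℕ ℤ, ∀ x : Pt, f x i = MvPolynomial.eval x p

/-- The orbit `{g x : g ∈ ⟨S⟩}`, where `⟨S⟩` is the monoid under composition (identity included)
generated by `S`. -/
def orbit (S : Set (Pt → Pt)) (x : Pt) : Set Pt :=
  {y | ∃ g ∈ Submonoid.closure (M := Function.End Pt) S, g x = y}

/-- `x` is `S`-stable: its `S`-orbit is finite. -/
def IsStable (S : Set (Pt → Pt)) (x : Pt) : Prop :=
  (orbit S x).Finite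

/-- Finite written form of a polynomial: a list of terms, each an integer coefficient
together with the list of (indices of) the variables that are multiplied, with repetition. -/
abbrev PolyExpr : Type := List (ℤ × List ℕ)

/-- The polynomial written by a `PolyExpr`. -/
noncomputable def PolyExpr.toPoly (t : PolyExpr) : MvPolynomial ℕ ℤ :=
  (t.map fun m => MvPolynomial.C m.1 * (m.2.map MvPolynomial.X).prod).sum

/-- The program `c` presents the map `f`: on every input `i` it halts and outputs (the code
number of) a written form of a polynomial that is the `i`-th component of `f`. -/
def PresentsMap (c : Code) (f : Pt → Pt) : Prop :=
  ∃ t : ℕ → PolyExpr, (∀ i, c.eval i = Part.some (Encodable.encode (t i))) ∧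
    ∀ (x : Pt) (i : ℕ), f x i = MvPolynomial.eval x (PolyExpr.toPoly (t i))

/-- The finite list of programs `L` presents the set of maps `S`. -/
def PresentsSet (L : List Code) (S : Set (Pt → Pt)) : Prop :=
  (∀ c ∈ L, ∃ f ∈ S, PresentsMap c f) ∧ (∀ f ∈ S, ∃ c ∈ L, PresentsMap c f)

/-- The program `c` presents the point `x`: on every input `i` it halts and outputs (the code
number of) `x i`. -/
def PresentsPoint (c : Code) (x : Pt) : Prop :=
  ∀ i, c.eval i = Part.some (Encodable.encode (x i))

/-- The finitely supported point `(l₀, …, lₙ₋₁, 0, 0, …)`. -/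
def ptOfList (l : List ℤ) : Pt := fun i => l.getD i 0

/-- The algorithm `A` decides stability: given programs that present a finite set `S` of
polynomial maps and a point `x`, it halts and answers correctly whether `x` is `S`-stable.
Nothing is asked of `A` on inputs that present nothing. -/
def DecidesStability (A : List Code × Code →. Bool) : Prop :=
  ∀ (L : List Code) (c : Code) (S : Set (Pt → Pt)) (x : Pt),
    S.Finite → (∀ f ∈ S, IsPolynomialMap f) → PresentsSet L S → PresentsPoint c x →
      ∃ b : Bool, b ∈ A (L, c) ∧ (b = true ↔ IsStable S x)

end PolyOrbit

namespace PolyOrbit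

section SingleMap

/-! The halting problem reduces to stability under one fixed map. Arrange the coordinates in rows,
one row per program `m`, with columns `t`. `clockMap` shifts every row one column to the right but
erases the entry in column `t` if `m` has halted within `t` steps. This test is primitive recursive,
so a program can write out the components, each being 0 or one variable. A unit entry started at
column 0 of row `m` visits infinitely many points if `m` runs forever on input 0, and otherwise ends
at the fixed point 0 (`isStable_clockMap_iff`). -/

theorem orbit_singleton (f : Pt → Pt) (x : Pt) : orbit {f} x = Set.range fun k : ℕ => f^[k] x := by
  ext y
  have hpow (k : ℕ) : (show Function.End Pt from f) ^ k = f^[k] := by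
    induction k with
    | zero => rfl
    | succ k ih => rw [pow_succ, ih]; rfl
  constructor
  · rintro ⟨g, hg, rfl⟩
    obtain ⟨k, rfl⟩ := Submonoid.mem_closure_singleton.1 hg
    exact ⟨k, (congrFun (hpow k) x).symm⟩
  · rintro ⟨k, rfl⟩
    exact ⟨_, Submonoid.mem_closure_singleton.2 ⟨k, rfl⟩, congrFun (hpow k) x⟩

/-- The forward orbit of a point is finite iff the sequence of iterates has a repetition. -/
theorem finite_range_iterate_iff {α : Type*} (f : α → α) (x : α) :
    (Set.range fun k : ℕ => f^[k] x).Finite ↔ ∃ k m : ℕ, m < k ∧ f^[k] x = f^[m] x := by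
  constructor
  · intro h
    by_contra! hne
    refine Set.infinite_range_of_injective (f := fun k : ℕ => f^[k] x) (fun a b hab => ?_) h
    rcases lt_trichotomy a b with hlt | rfl | hlt
    · exact (hne b a hlt hab.symm).elim
    · rfl
    · exact (hne a b hlt hab).elim
  · rintro ⟨k, m, hmk, h⟩
    refine ((Set.finite_Iio k).image fun j => f^[j] x).subset ?_
    rintro _ ⟨n, rfl⟩
    induction n using Nat.strong_induction_on with
    | _ n ih =>
      rcases lt_or_ge n k with hn | hn
      · exact ⟨n, hn, rfl⟩
      -- Since `m < k`, removing one period gives a smaller exponent, so the induction applies.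
      · have hstep : f^[n] x = f^[n - k + m] x := by
          conv_lhs => rw [← Nat.sub_add_cancel hn]
          rw [Function.iterate_add_apply, h, ← Function.iterate_add_apply]
        simpa only [hstep] using ih (n - k + m) (by omega)

theorem isStable_singleton_iff (f : Pt → Pt) (x : Pt) :
    IsStable {f} x ↔ ∃ k m : ℕ, m < k ∧ f^[k] x = f^[m] x := by
  rw [IsStable, orbit_singleton, finite_range_iterate_iff]

end SingleMap

section Clock

/-- Whether the program numbered `m` halts on input `0` within `t` steps. -/
def haltsWithin (m t : ℕ) : Bool :=
  (Code.evaln t (Denumerable.ofNat Code m) 0).isSome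

/-- Written form of the components of the clock map: the entry at coordinate `Nat.pair m t` moves
to coordinate `Nat.pair m (t + 1)`, unless the program numbered `m` halts within `t` steps. -/
def clockExpr (i : ℕ) : PolyExpr :=
  Nat.casesOn (motive := fun _ => PolyExpr) i.unpair.2 [] fun t =>
    bif haltsWithin i.unpair.1 t then [] else [(1, [Nat.pair i.unpair.1 t])]

/-- The polynomial map on `ℤ^ℕ` that runs all programs on input `0` simultaneously. -/
noncomputable def clockMap : Pt → Pt := fun x i =>
  MvPolynomial.eval x (clockExpr i).toPoly

theorem primrec_haltsWithin : Primrec₂ haltsWithin :=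
  Primrec.option_isSome.comp <| Code.primrec_evaln.comp <|
    (Primrec.snd.pair ((Primrec.ofNat Code).comp Primrec.fst)).pair (Primrec.const 0)

theorem primrec_clockExpr : Primrec clockExpr := by
  have hm : Primrec fun p : ℕ × ℕ => p.1.unpair.1 :=
    Primrec.fst.comp (Primrec.unpair.comp Primrec.fst)
  refine Primrec.nat_casesOn (Primrec.snd.comp Primrec.unpair) (Primrec.const []) ?_
  refine Primrec.cond (primrec_haltsWithin.comp hm Primrec.snd) (Primrec.const []) ?_
  exact Primrec.list_cons.comp ((Primrec.const 1).pair
    (Primrec.list_cons.comp (Primrec₂.natPair.comp hm Primrec.snd) (Primrec.const [])))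
    (Primrec.const [])

theorem isPolynomialMap_clockMap : IsPolynomialMap clockMap := fun i =>
  ⟨(clockExpr i).toPoly, fun _ => rfl⟩

/-- Every computable function on `ℕ` is computed, through the encoding of its values, by some
program. -/
theorem exists_code_of_computable {α : Type*} [Primcodable α] {g : ℕ → α} (hg : Computable g) :
    ∃ c : Code, ∀ i, c.eval i = Part.some (Encodable.encode (g i)) := by
  obtain ⟨c, hc⟩ := Code.exists_code.1 (Partrec.nat_iff.1 (Computable.encode.comp hg).partrec)
  exact ⟨c, fun i => congrFun hc i⟩

theorem exists_presentsMap_clockMap : ∃ c : Code, PresentsMap c clockMap := by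
  obtain ⟨c, hc⟩ := exists_code_of_computable primrec_clockExpr.to_comp
  exact ⟨c, clockExpr, hc, fun _ _ => rfl⟩

theorem clockMap_pair_zero (x : Pt) (m : ℕ) : clockMap x (Nat.pair m 0) = 0 := by
  simp [clockMap, clockExpr, PolyExpr.toPoly]

theorem clockMap_pair_succ (x : Pt) (m t : ℕ) :
    clockMap x (Nat.pair m (t + 1)) = if haltsWithin m t then 0 else x (Nat.pair m t) := by
  cases h : haltsWithin m t <;> simp [clockMap, clockExpr, PolyExpr.toPoly, h]

theorem clockMap_zero : clockMap 0 = 0 := by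
  funext i
  obtain ⟨m, t, rfl⟩ : ∃ m t, i = Nat.pair m t := ⟨_, _, (Nat.pair_unpair i).symm⟩
  cases t with
  | zero => exact clockMap_pair_zero _ _
  | succ t => simp [clockMap_pair_succ]

theorem clockMap_single (m t : ℕ) :
    clockMap (Pi.single (Nat.pair m t) 1) =
      if haltsWithin m t then 0 else Pi.single (Nat.pair m (t + 1)) 1 := by
  funext i
  obtain ⟨n, s, rfl⟩ : ∃ n s, i = Nat.pair n s := ⟨_, _, (Nat.pair_unpair i).symm⟩
  cases s with
  | zero => split_ifs <;> simp [clockMap_pair_zero, Nat.pair_eq_pair]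
  | succ s =>
    rw [clockMap_pair_succ]
    by_cases h : n = m ∧ s = t
    · obtain ⟨rfl, rfl⟩ := h
      split_ifs <;> simp
    · split_ifs <;> simp [Nat.pair_eq_pair, h]

/-- The unit entry acts as a step counter: it moves one column per iteration until the program has
halted. -/
theorem iterate_clockMap_single {m k : ℕ} (h : ∀ t < k, haltsWithin m t = false) :
    clockMap^[k] (Pi.single (Nat.pair m 0) 1) = Pi.single (Nat.pair m k) 1 := by
  induction k with
  | zero => rfl
  | succ k ih =>
    rw [Function.iterate_succ_apply', ih fun t ht => h t (by omega), clockMap_single,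
      h k (by omega)]
    simp

theorem exists_haltsWithin_iff (c : Code) :
    (∃ t, haltsWithin (Encodable.encode c) t = true) ↔ (c.eval 0).Dom := by
  simp only [haltsWithin, Denumerable.ofNat_encode, Option.isSome_iff_exists, Part.dom_iff_mem,
    Code.evaln_complete, Option.mem_def]
  exact exists_comm

theorem exists_iterate_clockMap_eq_iff (c : Code) :
    (∃ k m : ℕ, m < k ∧
      clockMap^[k] (Pi.single (Nat.pair (Encodable.encode c) 0) 1) =
        clockMap^[m] (Pi.single (Nat.pair (Encodable.encode c) 0) 1)) ↔ (c.eval 0).Dom := by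
  rw [← exists_haltsWithin_iff]
  constructor
  · rintro ⟨k, m, hmk, h⟩
    by_contra! hne
    simp only [ne_eq, Bool.not_eq_true] at hne
    rw [iterate_clockMap_single fun t _ => hne t, iterate_clockMap_single fun t _ => hne t] at h
    -- At this coordinate one side is 1 and the other is 0.
    have := congrFun h (Nat.pair (Encodable.encode c) k)
    simp [Nat.pair_eq_pair, hmk.ne'] at this
  · intro h
    -- The entry reaches the first halting column `Nat.find h` intact; one more iteration erases it.
    have hzero : clockMap^[Nat.find h + 1] (Pi.single (Nat.pair (Encodable.encode c) 0) 1) = 0 := by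
      rw [Function.iterate_succ_apply',
        iterate_clockMap_single fun t ht => Bool.not_eq_true _ ▸ Nat.find_min h ht,
        clockMap_single, Nat.find_spec h]
      simp
    exact ⟨Nat.find h + 1 + 1, Nat.find h + 1, by omega, by
      rw [Function.iterate_succ_apply', hzero, clockMap_zero]⟩

theorem isStable_clockMap_iff (c : Code) :
    IsStable {clockMap} (Pi.single (Nat.pair (Encodable.encode c) 0) 1) ↔ (c.eval 0).Dom := by
  rw [isStable_singleton_iff, exists_iterate_clockMap_eq_iff]

end Clock

section Reduction

/-- The list `[0, …, 0, 1]` whose last entry has index `n`. -/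
def singleList (n : ℕ) : List ℤ :=
  (List.range (n + 1)).map fun i => if i = n then 1 else 0

theorem ptOfList_singleList (n : ℕ) : ptOfList (singleList n) = Pi.single n 1 := by
  funext i
  rcases lt_or_ge i (n + 1) with h | h
  · simp [ptOfList, singleList, Pi.single_apply, List.getD_eq_getElem?_getD, h]
  · have : i ≠ n := by omega
    rw [ptOfList, List.getD_eq_default _ _ (by simpa [singleList] using h), Pi.single_eq_of_ne this]

theorem primrec_single : Primrec₂ fun n i : ℕ => if i = n then (1 : ℤ) else 0 :=
  Primrec.ite (Primrec.eq.comp Primrec.snd Primrec.fst) (Primrec.const 1) (Primrec.const 0)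

theorem primrec_singleList : Primrec singleList :=
  Primrec.list_map (Primrec.list_range.comp Primrec.succ) primrec_single

theorem primrec_pair_encode_zero : Primrec fun c : Code => Nat.pair (Encodable.encode c) 0 :=
  Primrec₂.natPair.comp Primrec.encode (Primrec.const 0)

/-- Undecidability of a property of lists follows if it detects halting on the unit lists. -/
theorem not_computablePred_of_singleList {p : List ℤ → Prop}
    (hp : ∀ c : Code, p (singleList (Nat.pair (Encodable.encode c) 0)) ↔ (c.eval 0).Dom) :
    ¬ ComputablePred p := fun h =>
  ComputablePred.halting_problem 0 <| ComputablePred.computable_of_manyOneReducible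
    ⟨fun c => singleList (Nat.pair (Encodable.encode c) 0),
      (primrec_singleList.comp primrec_pair_encode_zero).to_comp, fun c => (hp c).symm⟩ h

/-- There are programs presenting the unit points, uniformly in the index. -/
theorem exists_computable_presentsPoint_single :
    ∃ P : ℕ → Code, Computable P ∧ ∀ n, PresentsPoint (P n) (Pi.single n 1) := by
  have hg : Primrec fun k : ℕ => if k.unpair.2 = k.unpair.1 then (1 : ℤ) else 0 :=
    primrec_single.comp (Primrec.fst.comp Primrec.unpair) (Primrec.snd.comp Primrec.unpair)
  obtain ⟨c, hc⟩ := exists_code_of_computable hg.to_comp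
  -- One program tests `i = n` on the paired input; fixing `n` by currying is computable.
  refine ⟨c.curry, (Code.primrec₂_curry.comp (Primrec.const c) Primrec.id).to_comp, fun n i => ?_⟩
  rw [Code.eval_curry, hc]
  simp [Pi.single_apply]

theorem not_exists_partrec_decidesStability :
    ¬ ∃ A : List Code × Code →. Bool, Partrec A ∧ DecidesStability A := by
  rintro ⟨A, hA, hdec⟩
  obtain ⟨cf, hcf⟩ := exists_presentsMap_clockMap
  obtain ⟨P, hP, hpres⟩ := exists_computable_presentsPoint_single
  have key (c : Code) : ∃ b : Bool, b ∈ A ([cf], P (Nat.pair (Encodable.encode c) 0)) ∧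
      (b = true ↔ (c.eval 0).Dom) := by
    rw [← isStable_clockMap_iff]
    exact hdec _ _ _ _ (Set.finite_singleton _) (by simpa using isPolynomialMap_clockMap)
      ⟨by simpa using hcf, by simpa using hcf⟩ (hpres _)
  choose b hb hiff using key
  -- `A` may diverge elsewhere, but every query made here is a valid presentation, so its
  -- restriction to these queries is total.
  have hcomp : Computable b := by
    have hpart : Partrec fun c : Code => A ([cf], P (Nat.pair (Encodable.encode c) 0)) :=
      hA.comp ((Computable.const [cf]).pair (hP.comp primrec_pair_encode_zero.to_comp))
    exact hpart.of_eq fun c => Part.eq_some_iff.2 (hb c)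
  exact ComputablePred.halting_problem 0 <| ComputablePred.computable_iff.2
    ⟨b, hcomp, funext fun c => propext (hiff c).symm⟩

end Reduction

end PolyOrbit

theorem theorem1p3 :
    (¬ ∃ A : List Nat.Partrec.Code × Nat.Partrec.Code →. Bool,
        Partrec A ∧ PolyOrbit.DecidesStability A) ∧
    (∃ f : PolyOrbit.Pt → PolyOrbit.Pt,
        PolyOrbit.IsPolynomialMap f ∧
        (∃ c : Nat.Partrec.Code, PolyOrbit.PresentsMap c f) ∧
        (¬ ComputablePred fun l : List ℤ =>
            PolyOrbit.IsStable {f} (PolyOrbit.ptOfList l)) ∧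
        (¬ ComputablePred fun l : List ℤ =>
            ∃ k m : ℕ, m < k ∧
              f^[k] (PolyOrbit.ptOfList l) = f^[m] (PolyOrbit.ptOfList l))) ∧
    (∀ f : PolyOrbit.Pt → PolyOrbit.Pt, PolyOrbit.IsPolynomialMap f →
        ∀ x : PolyOrbit.Pt, PolyOrbit.IsStable {f} x ↔
          ∃ k m : ℕ, m < k ∧ f^[k] x = f^[m] x) := by
  refine ⟨PolyOrbit.not_exists_partrec_decidesStability,
    ⟨PolyOrbit.clockMap, PolyOrbit.isPolynomialMap_clockMap,
      PolyOrbit.exists_presentsMap_clockMap,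
      PolyOrbit.not_computablePred_of_singleList fun c => ?_,
      PolyOrbit.not_computablePred_of_singleList fun c => ?_⟩,
    fun f _ x => PolyOrbit.isStable_singleton_iff f x⟩
  · rw [PolyOrbit.ptOfList_singleList, PolyOrbit.isStable_clockMap_iff]
  · rw [PolyOrbit.ptOfList_singleList, PolyOrbit.exists_iterate_clockMap_eq_iff]
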